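/- Let $\mathcal X$ be a separable metric space with its Borel $\sigma$-algebra, and let $\mathcal M$ be the set of all probability measures on $\mathcal X$, with the $\sigma$-algebra generated by the maps $Q\mapsto Q(B)$, $B\subseteq\mathcal X$ Borel. For $Q\in\mathcal M$ let $A_Q=\{x\colon Q\{x\}>0\}$ be its set of atoms and $H_0(Q)=\sum_{x\in A_Q}Q\{x\}$ their total mass; call $Q$ discrete if $Q(S^c)=0$ for some countable set $S$. Let $k>0$ and let $P_0$ be a probability measure on $\mathcal X$. A Dirichlet process with parameter $kP_0$ is a random element $P$ of $\mathcal M$, defined on some probability space, such that for every finite Borel partition $B_1,\dots,B_n$ of $\mathcal X$ the vector $(P(B_1),\dots,P(B_n))$ has the Dirichlet distribution with parameters $(kP_0(B_1),\dots,kP_0(B_n))$, i.e. it is distributed as $(G_1/G,\dots,G_n/G)$ with $G=G_1+\cdots+G_n$ and $G_1,\dots,G_n$ independent, $G_i$ being Gamma distributed with shape $kP_0(B_i)$ and rate $1$ (and $G_i=0$ if $kP_0(B_i)=0$). Then: 1. The map $(Q,x)\mapsto Q\{x\}$ is jointly measurable on $\mathcal M\times\mathcal X$, $H_0$ is measurable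 on $\mathcal M$, and the set of all discrete probability measures is a measurable subset of $\mathcal M$. 2. If $P$ is a Dirichlet process with parameter $kP_0$, then with probability one $H_0(P)=\sum_{x\in A_P}P\{x\}=1$ and $P$ is discrete. -/

import Mathlib

open MeasureTheory ProbabilityTheory
open scoped NNReal ENNReal

/-- The Gamma distribution with shape `a ≥ 0` and rate `1`; shape `0` is the point mass at `0`. -/
noncomputable def gammaLaw (a : ℝ) : Measure ℝ :=
  if 0 < a then gammaMeasure a 1 else Measure.dirac 0

/-- The finite-dimensional Dirichlet distribution with parameters `a i ≥ 0`, not all zero: the law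
of `(G₁ / (G₁ + ⋯ + Gₙ), …, Gₙ / (G₁ + ⋯ + Gₙ))` for independent `Gᵢ ∼ Gamma(aᵢ, 1)`. -/
noncomputable def dirichletLaw {n : ℕ} (a : Fin n → ℝ) : Measure (Fin n → ℝ) :=
  (Measure.pi fun i => gammaLaw (a i)).map fun g i => g i / ∑ j, g j

/-- The random probability measure `P`, defined on the probability space `(Ω, μ)`, is a Dirichlet
process with parameter the finite nonzero measure `α`: for each finite measurable partition
`B₁, …, Bₙ` of `X`, the vector `(P B₁, …, P Bₙ)` has the Dirichlet distribution with parameters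
`(α B₁, …, α Bₙ)`. The space of probability measures on `X` carries the σ-algebra generated by the
evaluations `Q ↦ Q B` at measurable sets `B`. -/
structure IsDirichletProcess {Ω X : Type*} [MeasurableSpace Ω] [MeasurableSpace X]
    (α : Measure X) (P : Ω → ProbabilityMeasure X) (μ : Measure Ω) : Prop where
  measurable : Measurable P
  map_partition : ∀ (n : ℕ) (B : Fin n → Set X), (∀ i, MeasurableSet (B i)) →
    Pairwise (fun i j => Disjoint (B i) (B j)) → (⋃ i, B i) = Set.univ →
    μ.map (fun ω i => (P ω : Measure X).real (B i)) = dirichletLaw fun i => α.real (B i)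

/-- The set `A_Q` of atoms of `Q`. -/
def atomSet {X : Type*} [MeasurableSpace X] (Q : ProbabilityMeasure X) : Set X :=
  {x | 0 < (Q : Measure X) {x}}

/-- The total mass `H₀(Q)` of the atoms of `Q`. -/
noncomputable def atomicMass {X : Type*} [MeasurableSpace X] (Q : ProbabilityMeasure X) : ℝ≥0∞ :=
  ∑' x : atomSet Q, (Q : Measure X) {(x : X)}

/-- A probability measure is discrete if it is concentrated on a countable set. -/
def IsDiscreteProb {X : Type*} [MeasurableSpace X] (Q : ProbabilityMeasure X) : Prop :=
  ∃ S : Set X, S.Countable ∧ (Q : Measure X) Sᶜ = 0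

/-! ### Atoms: measurability, and approximation by refining partitions. -/

section Atoms

variable {X : Type*} [MeasurableSpace X]

/-! Measurability comes from the measurable diagonal of `X × X`. For discreteness, write `α = kP₀`.
Since `P(A)` is Beta distributed with parameters `α(A)`, `α(Aᶜ)`, its density yields `E[P(A); P(A) ≤
ε] ≤ C ε α(A)` with `C` independent of `A` (`IsDirichletProcess.exists_lintegral_truncId_le`). This
bound is additive in `A`, so summing over the cells of a countable partition bounds the expected
mass in cells of mass at most `ε` by `C ε α(X)`, however fine the partition.

Along partitions shrinking to points, a non-atom eventually lies in such small cells, so Fatou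
bounds the non-atomic mass by the liminf of the small-cell masses
(`measure_compl_atomSet_le_liminf`). A second Fatou, over `Ω`, and `ε → 0` show that its expectation
vanishes. -/

/-- The tautological Markov kernel from probability measures on `X` to `X`. -/
noncomputable def evalKernel (X : Type*) [MeasurableSpace X] : Kernel (ProbabilityMeasure X) X :=
  ⟨fun Q => (Q : Measure X), measurable_subtype_coe⟩

instance : IsMarkovKernel (evalKernel X) := ⟨fun Q => Q.2⟩

lemma measurable_measure_singleton [MeasurableEq X] :
    Measurable (fun p : ProbabilityMeasure X × X => (p.1 : Measure X) {p.2}) := by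
  have h : MeasurableSet {q : (ProbabilityMeasure X × X) × X | q.2 = q.1.2} :=
    measurableSet_eq_fun measurable_snd measurable_fst.snd
  exact Kernel.measurable_kernel_prodMk_left (κ := (evalKernel X).prodMkRight X) h

lemma countable_atomSet [MeasurableSingletonClass X] (Q : ProbabilityMeasure X) :
    (atomSet Q).Countable :=
  Measure.countable_meas_level_set_pos (μ := (Q : Measure X)) measurable_id

lemma atomicMass_eq [MeasurableSingletonClass X] (Q : ProbabilityMeasure X) :
    atomicMass Q = (Q : Measure X) (atomSet Q) := by
  have h := lintegral_countable (μ := (Q : Measure X)) (fun _ => 1) (countable_atomSet Q)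
  simpa [atomicMass] using h.symm

lemma measurable_atomicMass [MeasurableEq X] [MeasurableSingletonClass X] :
    Measurable (fun Q : ProbabilityMeasure X => atomicMass Q) := by
  simp_rw [atomicMass_eq]
  exact Kernel.measurable_kernel_prodMk_left (κ := evalKernel X)
    (measurableSet_lt measurable_const measurable_measure_singleton)

/-- A countable set of non-atoms is null, so a countable carrier can be replaced by the atoms it
contains. -/
lemma isDiscreteProb_iff [MeasurableSingletonClass X] (Q : ProbabilityMeasure X) :
    IsDiscreteProb Q ↔ atomicMass Q = 1 := by
  rw [atomicMass_eq, ← prob_compl_eq_zero_iff (countable_atomSet Q).measurableSet]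
  refine ⟨?_, fun h => ⟨_, countable_atomSet Q, h⟩⟩
  rintro ⟨S, hS, h⟩
  have h0 : (Q : Measure X) (S ∩ (atomSet Q)ᶜ) = 0 := by
    rw [measure_null_iff_singleton (hS.mono Set.inter_subset_left)]
    intro x hx
    simpa [atomSet] using hx.2
  refine measure_mono_null (fun x hx => ?_) (measure_union_null h h0)
  by_cases hxS : x ∈ S
  · exact Or.inr ⟨hxS, hx⟩
  · exact Or.inl hxS

/-- The cells around `x` decrease to the measurable atom of `x`, which is `{x}`; continuity from
above concludes. -/
lemma tendsto_measure_countablePartitionSet [MeasurableSpace.CountablyGenerated X]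
    [MeasurableSingletonClass X] (Q : ProbabilityMeasure X) (x : X) :
    Filter.Tendsto (fun n => (Q : Measure X) (MeasurableSpace.countablePartitionSet n x))
      Filter.atTop (nhds ((Q : Measure X) {x})) := by
  classical
  set t := MeasurableSpace.natGeneratingSequence X
  have hsucc : ∀ n, MeasurableSpace.countablePartitionSet (n + 1) x =
      if x ∈ t n then MeasurableSpace.countablePartitionSet n x ∩ t n
      else MeasurableSpace.countablePartitionSet n x \ t n := fun n => memPartitionSet_succ t n x
  have hanti : Antitone fun n => MeasurableSpace.countablePartitionSet n x := by
    refine antitone_nat_of_succ_le fun n => ?_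
    rw [hsucc]
    split_ifs
    · exact Set.inter_subset_left
    · exact Set.sdiff_subset
  have hInter : ⋂ n, MeasurableSpace.countablePartitionSet n x = {x} := by
    refine Set.Subset.antisymm (fun y hy => ?_) (Set.singleton_subset_iff.2 <|
      Set.mem_iInter.2 fun n => MeasurableSpace.mem_countablePartitionSet n x)
    rw [← measurableAtom_of_measurableSingletonClass x,
      MeasurableSpace.measurableAtom_eq_countablyGeneratedAtom_natGeneratingSequence]
    refine Set.mem_iInter.2 fun n => ?_
    have h := Set.mem_iInter.1 hy (n + 1)
    rw [hsucc] at h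
    by_cases hx : x ∈ t n
    · rw [if_pos hx] at h
      rw [if_pos hx]
      exact h.2
    · rw [if_neg hx] at h
      rw [if_neg hx]
      exact h.2
  rw [← hInter]
  exact tendsto_measure_iInter_atTop
    (fun n => (MeasurableSpace.measurableSet_countablePartitionSet n x).nullMeasurableSet) hanti
    ⟨0, measure_ne_top _ _⟩

end Atoms

/-! ### Truncated first moment of a Beta variable, via Gamma integrals. -/

section Gamma

open Real

instance isProbabilityMeasure_gammaLaw (a : ℝ) : IsProbabilityMeasure (gammaLaw a) := by
  unfold gammaLaw
  split_ifs with h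
  · exact isProbabilityMeasure_gammaMeasure h one_pos
  · infer_instance

@[fun_prop]
lemma measurable_gammaPDF (a r : ℝ) : Measurable (gammaPDF a r) :=
  (measurable_gammaPDFReal a r).ennreal_ofReal

/-- The identity, truncated to `0` above the level `ε`. -/
noncomputable def truncId (ε y : ℝ) : ℝ≥0∞ := if y ≤ ε then ENNReal.ofReal y else 0

lemma measurable_truncId (ε : ℝ) : Measurable (truncId ε) :=
  Measurable.ite measurableSet_Iic ENNReal.measurable_ofReal measurable_const

/-- As `ε ≤ 1 / 2`, the truncation forces `x ≤ 2εy`. The ratio is at most `x / y`, which raises `x ^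
(a - 1)` to the increasing `x ^ a`, bounded by its value at `2εy`. -/
lemma truncId_div_mul_gammaPDF_le {a ε x y : ℝ} (ha : 0 < a) (hε : ε ≤ 1 / 2) (hy : 0 < y) :
    truncId ε (x / (x + y)) * gammaPDF a 1 x ≤
      (Set.Icc 0 (2 * ε * y)).indicator
        (fun _ => ENNReal.ofReal (a / Gamma (a + 1) * (2 * ε * y) ^ a / y)) x := by
  rcases lt_or_ge x 0 with hx | hx
  · simp [gammaPDF_of_neg hx]
  unfold truncId
  split_ifs with h
  swap
  · simp
  rw [div_le_iff₀ (by linarith)] at h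
  have hle : x ≤ 2 * ε * y := by nlinarith
  rw [Set.indicator_of_mem (show x ∈ Set.Icc 0 (2 * ε * y) from ⟨hx, hle⟩), gammaPDF_of_nonneg hx, ← ENNReal.ofReal_mul (by positivity)]
  refine ENNReal.ofReal_le_ofReal ?_
  have hG := Gamma_pos_of_pos ha
  rcases hx.eq_or_lt with rfl | hx'
  · simp only [zero_div, zero_mul]
    positivity
  calc x / (x + y) * (1 ^ a / Gamma a * x ^ (a - 1) * exp (-(1 * x)))
      ≤ x / y * (1 / Gamma a * x ^ (a - 1) * 1) := by
        rw [one_rpow]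
        gcongr
        · linarith
        · rw [exp_le_one_iff]; linarith
    _ = a / Gamma (a + 1) * x ^ a / y := by
        rw [rpow_sub_one hx'.ne', Gamma_add_one ha.ne']
        field_simp
    _ ≤ _ := by gcongr

lemma lintegral_truncId_div_le {a ε y : ℝ} (ha : 0 < a) (hε0 : 0 < ε) (hε : ε ≤ 1 / 2)
    (hy : 0 < y) :
    ∫⁻ x, truncId ε (x / (x + y)) ∂(gammaLaw a) ≤
      ENNReal.ofReal (2 * ε * a / Gamma (a + 1) * y ^ a) := by
  rw [gammaLaw, if_pos ha, gammaMeasure,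
    lintegral_withDensity_eq_lintegral_mul _ (measurable_gammaPDF a 1)
      (g := fun x => truncId ε (x / (x + y))) ((measurable_truncId ε).comp (by fun_prop))]
  calc _ ≤ ∫⁻ x, (Set.Icc 0 (2 * ε * y)).indicator
        (fun _ => ENNReal.ofReal (a / Gamma (a + 1) * (2 * ε * y) ^ a / y)) x := by
        refine lintegral_mono fun x => ?_
        rw [Pi.mul_apply, mul_comm]
        exact truncId_div_mul_gammaPDF_le ha hε hy
    _ = ENNReal.ofReal (a / Gamma (a + 1) * (2 * ε * y) ^ a / y * (2 * ε * y)) := by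
        rw [lintegral_indicator_const measurableSet_Icc, Real.volume_Icc, sub_zero,
          ← ENNReal.ofReal_mul (by positivity)]
    _ ≤ _ := by
        refine ENNReal.ofReal_le_ofReal ?_
        have h1 : (2 * ε * y) ^ a ≤ y ^ a := by
          gcongr
          nlinarith
        calc a / Gamma (a + 1) * (2 * ε * y) ^ a / y * (2 * ε * y)
            = 2 * ε * a / Gamma (a + 1) * (2 * ε * y) ^ a := by field_simp
          _ ≤ _ := by gcongr

/-- On `y > 0`, the factor `y ^ a` turns the `Gamma(b)` density into a multiple of the `Gamma(a +
b)` density. -/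
lemma lintegral_rpow_gammaPDF {a b : ℝ} (ha : 0 < a) (hb : 0 < b) :
    ∫⁻ y in Set.Ioi 0, gammaPDF b 1 y * ENNReal.ofReal (y ^ a) ≤
      ENNReal.ofReal (Gamma (a + b) / Gamma b) := by
  calc _ = ∫⁻ y in Set.Ioi 0, ENNReal.ofReal (Gamma (a + b) / Gamma b) * gammaPDF (a + b) 1 y := by
        refine setLIntegral_congr_fun measurableSet_Ioi fun y hy => ?_
        have hy : 0 < y := hy
        have hab := Gamma_pos_of_pos (add_pos ha hb)
        have hbb := Gamma_pos_of_pos hb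
        rw [gammaPDF_of_nonneg hy.le, gammaPDF_of_nonneg hy.le,
          ← ENNReal.ofReal_mul (by positivity), ← ENNReal.ofReal_mul (by positivity)]
        congr 1
        rw [add_sub_assoc, rpow_add hy]
        simp only [one_rpow]
        field_simp
    _ ≤ ∫⁻ y, ENNReal.ofReal (Gamma (a + b) / Gamma b) * gammaPDF (a + b) 1 y :=
        setLIntegral_le_lintegral _ _
    _ = _ := by
        rw [lintegral_const_mul _ (measurable_gammaPDF _ _),
          lintegral_gammaPDF_eq_one (add_pos ha hb) one_pos, mul_one]

lemma lintegral_lintegral_truncId_div_le {a b ε : ℝ} (ha : 0 < a) (hb : 0 < b) (hε0 : 0 < ε)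
    (hε : ε ≤ 1 / 2) :
    ∫⁻ y, ∫⁻ x, truncId ε (x / (x + y)) ∂(gammaLaw a) ∂(gammaLaw b) ≤
      ENNReal.ofReal (2 * ε * a * Gamma (a + b) / (Gamma (a + 1) * Gamma b)) := by
  have hm : Measurable fun y => ∫⁻ x, truncId ε (x / (x + y)) ∂(gammaLaw a) :=
    Measurable.lintegral_prod_right' (f := fun p : ℝ × ℝ => truncId ε (p.2 / (p.2 + p.1)))
      ((measurable_truncId ε).comp (by fun_prop))
  have hG := Gamma_pos_of_pos (add_pos ha one_pos)
  conv_lhs => rw [gammaLaw, if_pos hb, gammaMeasure]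
  rw [lintegral_withDensity_eq_lintegral_mul _ (measurable_gammaPDF b 1) hm]
  have h0 : ∫⁻ y, (gammaPDF b 1 * fun y => ∫⁻ x, truncId ε (x / (x + y)) ∂(gammaLaw a)) y =
      ∫⁻ y in Set.Ioi 0,
        (gammaPDF b 1 * fun y => ∫⁻ x, truncId ε (x / (x + y)) ∂(gammaLaw a)) y := by
    rw [setLIntegral_congr Ioi_ae_eq_Ici, ← lintegral_indicator measurableSet_Ici]
    congr 1 with y
    rcases lt_or_ge y 0 with hy | hy
    · simp [gammaPDF_of_neg hy, hy]
    · rw [Set.indicator_of_mem (Set.mem_Ici.2 hy)]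
  rw [h0]
  calc _ ≤ ∫⁻ y in Set.Ioi 0, ENNReal.ofReal (2 * ε * a / Gamma (a + 1)) *
        (gammaPDF b 1 y * ENNReal.ofReal (y ^ a)) := by
        refine setLIntegral_mono' measurableSet_Ioi fun y hy => ?_
        rw [Pi.mul_apply, mul_left_comm, ← ENNReal.ofReal_mul (by positivity)]
        gcongr
        exact lintegral_truncId_div_le ha hε0 hε hy
    _ ≤ ENNReal.ofReal (2 * ε * a / Gamma (a + 1)) * ENNReal.ofReal (Gamma (a + b) / Gamma b) := by
        rw [lintegral_const_mul _ (by fun_prop)]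
        gcongr
        exact lintegral_rpow_gammaPDF ha hb
    _ = _ := by
        rw [← ENNReal.ofReal_mul (by positivity)]
        congr 1
        field_simp

/-- The normalizing constants of the Beta distributions with parameters `a + 1` and `b` are bounded
uniformly when `a + b` is fixed. -/
lemma exists_Gamma_div_le {k : ℝ} (hk : 0 < k) :
    ∃ C : ℝ, ∀ a b : ℝ, 0 < a → 0 < b → a + b = k →
      Gamma (a + b) / (Gamma (a + 1) * Gamma b) ≤ C := by
  have hcont : ContinuousOn Gamma (Set.Icc 1 (k + 1)) := fun s hs =>
    (differentiableAt_Gamma fun m => by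
      have : (0 : ℝ) ≤ m := m.cast_nonneg
      have := hs.1
      linarith).continuousAt.continuousWithinAt
  obtain ⟨s, hs, hmin⟩ := isCompact_Icc.exists_isMinOn (Set.nonempty_Icc.2 (by linarith)) hcont
  have hm : 0 < Gamma s := Gamma_pos_of_pos (by linarith [hs.1])
  have hGk := Gamma_pos_of_pos hk
  -- Writing `1 / Γ(b) = b / Γ(b + 1)` puts both Gamma arguments in `[1, k + 1]`, where `Γ` is at
  -- least `Γ(s) > 0`.
  refine ⟨Gamma k * k / (Gamma s * Gamma s), fun a b ha hb hab => ?_⟩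
  have h1 : Gamma s ≤ Gamma (a + 1) := hmin ⟨by linarith, by linarith⟩
  have h2 : Gamma s ≤ Gamma (b + 1) := hmin ⟨by linarith, by linarith⟩
  have hGb := Gamma_pos_of_pos hb
  calc Gamma (a + b) / (Gamma (a + 1) * Gamma b)
      = Gamma k * b / (Gamma (a + 1) * Gamma (b + 1)) := by
        rw [Gamma_add_one hb.ne', hab]
        field_simp
    _ ≤ _ := by
        gcongr
        linarith

lemma lintegral_dirichletLaw_two {a : Fin 2 → ℝ} {f : ℝ → ℝ≥0∞} (hf : Measurable f) :
    ∫⁻ v, f (v 0) ∂(dirichletLaw a) =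
      ∫⁻ y, ∫⁻ x, f (x / (x + y)) ∂(gammaLaw (a 0)) ∂(gammaLaw (a 1)) := by
  have hF : Measurable fun p : ℝ × ℝ => f (p.1 / (p.1 + p.2)) := hf.comp (by fun_prop)
  rw [dirichletLaw, lintegral_map (f := fun v : Fin 2 → ℝ => f (v 0)) (by fun_prop) (by fun_prop)]
  simp only [Fin.sum_univ_two]
  rw [← lintegral_prod_symm' _ hF,
    ← (measurePreserving_piFinTwo fun i => gammaLaw (a i)).lintegral_comp hF]
  rfl

end Gamma

/-! ### Small cells under a Dirichlet process. -/

section DirichletProcess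

variable {Ω X : Type*} [MeasurableSpace Ω] [MeasurableSpace X] {μ : Measure Ω}
  {α : Measure X} {P : Ω → ProbabilityMeasure X}

lemma IsDirichletProcess.measurable_apply (hP : IsDirichletProcess α P μ) {A : Set X}
    (hA : MeasurableSet A) : Measurable fun ω => (P ω : Measure X) A :=
  (Measure.measurable_coe hA).comp (measurable_subtype_coe.comp hP.measurable)

lemma IsDirichletProcess.measurable_real (hP : IsDirichletProcess α P μ) {A : Set X}
    (hA : MeasurableSet A) : Measurable fun ω => (P ω : Measure X).real A :=
  (hP.measurable_apply hA).ennreal_toReal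

lemma IsDirichletProcess.lintegral_comp_real (hP : IsDirichletProcess α P μ) {A : Set X}
    (hA : MeasurableSet A) {f : ℝ → ℝ≥0∞} (hf : Measurable f) :
    ∫⁻ ω, f ((P ω : Measure X).real A) ∂μ =
      ∫⁻ y, ∫⁻ x, f (x / (x + y)) ∂(gammaLaw (α.real A)) ∂(gammaLaw (α.real Aᶜ)) := by
  have hB : ∀ i, MeasurableSet ((![A, Aᶜ] : Fin 2 → Set X) i) := by
    simp [Fin.forall_fin_two, hA, hA.compl]
  have hmap := hP.map_partition 2 ![A, Aᶜ] hB
    (by simp [Pairwise, Fin.forall_fin_two, disjoint_compl_right, disjoint_compl_left])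
    (by rw [Set.eq_univ_iff_forall]; simp [Fin.exists_fin_two, em])
  have h := lintegral_dirichletLaw_two (a := fun i => α.real ((![A, Aᶜ] : Fin 2 → Set X) i)) hf
  rw [← hmap, lintegral_map (f := fun v : Fin 2 → ℝ => f (v 0)) (by fun_prop)
    (measurable_pi_iff.2 fun i => hP.measurable_real (hB i))] at h
  exact h

/-- The mass that a Dirichlet process gives to `A` is rarely small under the size-biased law. -/
lemma IsDirichletProcess.exists_lintegral_truncId_le [IsFiniteMeasure α] [NeZero α]
    (hP : IsDirichletProcess α P μ) :
    ∃ C : ℝ, ∀ ε : ℝ, 0 < ε → ε ≤ 1 / 2 → ∀ A : Set X, MeasurableSet A →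
      ∫⁻ ω, truncId ε ((P ω : Measure X).real A) ∂μ ≤ ENNReal.ofReal (C * ε) * α A := by
  obtain ⟨C, h⟩ := exists_Gamma_div_le (measureReal_univ_pos (μ := α))
  refine ⟨2 * C, fun ε hε0 hε A hA => ?_⟩
  rw [hP.lintegral_comp_real hA (measurable_truncId ε)]
  rcases (measureReal_nonneg (μ := α) (s := A)).eq_or_lt with ha | ha
  · simp [← ha, gammaLaw, truncId]
  rcases (measureReal_nonneg (μ := α) (s := Aᶜ)).eq_or_lt with hb | hb
  -- If `α(Aᶜ) = 0` the ratio is `1 > ε`, or `0 / 0 = 0` at the origin; the truncation kills both.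
  · have h0 : ∀ x : ℝ, truncId ε (x / (x + 0)) = 0 := by
      intro x
      rcases eq_or_ne x 0 with rfl | hx
      · simp [truncId]
      · rw [add_zero, div_self hx, truncId, if_neg (by linarith)]
    rw [← hb, show gammaLaw 0 = Measure.dirac 0 by simp [gammaLaw]]
    have hm : Measurable fun y => ∫⁻ x, truncId ε (x / (x + y)) ∂(gammaLaw (α.real A)) :=
      Measurable.lintegral_prod_right' (f := fun p : ℝ × ℝ => truncId ε (p.2 / (p.2 + p.1)))
        ((measurable_truncId ε).comp (by fun_prop))
    rw [lintegral_dirac' _ hm]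
    simp_rw [h0]
    simp
  · refine (lintegral_lintegral_truncId_div_le ha hb hε0 hε).trans ?_
    rw [← ofReal_measureReal (μ := α) (s := A), ← ENNReal.ofReal_mul' measureReal_nonneg]
    refine ENNReal.ofReal_le_ofReal ?_
    rw [mul_div_assoc]
    calc _ ≤ 2 * ε * α.real A * C := by
          gcongr
          exact h _ _ ha hb (measureReal_add_measureReal_compl hA)
      _ = _ := by ring

variable [MeasurableSpace.CountablyGenerated X]

/-- The mass that `Q` gives to the cells of the `n`-th countable partition with mass at most `ε`. -/
noncomputable def smallCellMass (ε : ℝ) (n : ℕ) (Q : ProbabilityMeasure X) : ℝ≥0∞ :=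
  ∑' A : MeasurableSpace.countablePartition X n, truncId ε ((Q : Measure X).real A)

/-- Rewrites the sum over cells as an integral over points, the form to which Fatou applies. -/
lemma lintegral_indicator_small_cell (ε : ℝ) (n : ℕ) (Q : ProbabilityMeasure X) :
    ∫⁻ x, (if (Q : Measure X).real (MeasurableSpace.countablePartitionSet n x) ≤ ε then 1 else 0)
      ∂(Q : Measure X) = smallCellMass ε n Q := by
  have hU : ⋃ A : MeasurableSpace.countablePartition X n, (A : Set X) = Set.univ := by
    rw [← Set.sUnion_eq_iUnion, MeasurableSpace.sUnion_countablePartition]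
  rw [← setLIntegral_univ, ← hU, lintegral_iUnion
    (fun A => MeasurableSpace.measurableSet_countablePartition n A.2)
    (fun A B hAB => MeasurableSpace.disjoint_countablePartition A.2 B.2
      (Subtype.coe_injective.ne hAB))]
  refine tsum_congr fun A => ?_
  rw [setLIntegral_congr_fun (g := fun _ => if (Q : Measure X).real A ≤ ε then 1 else 0)
    (MeasurableSpace.measurableSet_countablePartition n A.2)
    (fun x hx => by simp only [MeasurableSpace.countablePartitionSet_of_mem A.2 hx]),
    setLIntegral_const, truncId]
  split_ifs
  · simp
  · simp

lemma IsDirichletProcess.measurable_smallCellMass (hP : IsDirichletProcess α P μ) (ε : ℝ) (n : ℕ) :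
    Measurable fun ω => smallCellMass ε n (P ω) :=
  Measurable.tsum fun A => (measurable_truncId ε).comp
    (hP.measurable_real (MeasurableSpace.measurableSet_countablePartition n A.2))

lemma IsDirichletProcess.lintegral_smallCellMass_le (hP : IsDirichletProcess α P μ) {ε : ℝ}
    {c : ℝ≥0∞} (h : ∀ A : Set X, MeasurableSet A →
      ∫⁻ ω, truncId ε ((P ω : Measure X).real A) ∂μ ≤ c * α A) (n : ℕ) :
    ∫⁻ ω, smallCellMass ε n (P ω) ∂μ ≤ c * α Set.univ := by
  have hm := fun A : MeasurableSpace.countablePartition X n =>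
    MeasurableSpace.measurableSet_countablePartition n A.2
  unfold smallCellMass
  rw [lintegral_tsum (f := fun (A : MeasurableSpace.countablePartition X n) ω =>
      truncId ε ((P ω : Measure X).real A)) fun A =>
    ((measurable_truncId ε).comp (hP.measurable_real (hm A))).aemeasurable]
  refine (ENNReal.tsum_le_tsum fun A => h _ (hm A)).trans ?_
  rw [ENNReal.tsum_mul_left, ← measure_iUnion (fun A B hAB =>
      MeasurableSpace.disjoint_countablePartition A.2 B.2 (Subtype.coe_injective.ne hAB)) hm]
  gcongr
  exact Set.subset_univ _

lemma measure_compl_atomSet_le_liminf [MeasurableSingletonClass X] {ε : ℝ} (hε : 0 < ε)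
    (Q : ProbabilityMeasure X) :
    (Q : Measure X) (atomSet Q)ᶜ ≤
      Filter.liminf (fun n => smallCellMass ε n Q) Filter.atTop := by
  simp_rw [← lintegral_indicator_small_cell]
  refine le_trans ?_ (lintegral_liminf_le fun n => ?_)
  · rw [← lintegral_indicator_one (countable_atomSet Q).measurableSet.compl]
    refine lintegral_mono fun x => ?_
    by_cases hx : x ∈ (atomSet Q)ᶜ
    · have h0 : (Q : Measure X) {x} = 0 := by simpa [atomSet] using hx
      have ht := (ENNReal.tendsto_toReal (measure_ne_top (Q : Measure X) {x})).comp
        (tendsto_measure_countablePartitionSet Q x)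
      rw [h0, ENNReal.toReal_zero] at ht
      rw [Set.indicator_of_mem hx]
      refine Filter.le_liminf_of_le (by isBoundedDefault) ?_
      filter_upwards [ht.eventually (gt_mem_nhds hε)] with n hn
      rw [if_pos (show (Q : Measure X).real _ ≤ ε from hn.le), Pi.one_apply]
    · rw [Set.indicator_of_notMem hx]
      exact zero_le
  · have hm : Measurable fun x =>
        (Q : Measure X).real (MeasurableSpace.countablePartitionSet n x) :=
      (measurable_from_top (f := fun A : MeasurableSpace.countablePartition X n =>
        (Q : Measure X).real A)).comp ((measurable_countablePartitionSet_subtype n ⊤).mono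
          ((countableFiltration X).le n) le_rfl)
    exact Measurable.ite (hm measurableSet_Iic) measurable_const measurable_const

lemma IsDirichletProcess.ae_measure_compl_atomSet [MeasurableEq X]
    [MeasurableSingletonClass X] [IsFiniteMeasure α] [NeZero α] (hP : IsDirichletProcess α P μ) :
    ∀ᵐ ω ∂μ, (P ω : Measure X) (atomSet (P ω))ᶜ = 0 := by
  obtain ⟨C, hC⟩ := hP.exists_lintegral_truncId_le
  have key : ∀ ε : ℝ, 0 < ε → ε ≤ 1 / 2 →
      ∫⁻ ω, (P ω : Measure X) (atomSet (P ω))ᶜ ∂μ ≤ ENNReal.ofReal (C * ε) * α Set.univ := by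
    intro ε hε0 hε
    calc _ ≤ ∫⁻ ω, Filter.liminf (fun n => smallCellMass ε n (P ω)) Filter.atTop ∂μ :=
          lintegral_mono fun ω => measure_compl_atomSet_le_liminf hε0 (P ω)
      _ ≤ Filter.liminf (fun n => ∫⁻ ω, smallCellMass ε n (P ω) ∂μ) Filter.atTop :=
          lintegral_liminf_le fun n => hP.measurable_smallCellMass ε n
      _ ≤ _ := by
          refine Filter.liminf_le_of_le (by isBoundedDefault) fun b hb => ?_
          obtain ⟨n, hn⟩ := hb.exists
          exact hn.trans (hP.lintegral_smallCellMass_le (hC ε hε0 hε) n)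
  have h0 : ∫⁻ ω, (P ω : Measure X) (atomSet (P ω))ᶜ ∂μ = 0 := by
    have hlim : Filter.Tendsto (fun ε : ℝ => ENNReal.ofReal (C * ε) * α Set.univ)
        (nhdsWithin 0 (Set.Ioi 0)) (nhds (ENNReal.ofReal (C * 0) * α Set.univ)) :=
      (ENNReal.Tendsto.mul_const ((ENNReal.continuous_ofReal.comp
        (continuous_const.mul continuous_id)).tendsto 0)
        (Or.inr (measure_ne_top _ _))).mono_left nhdsWithin_le_nhds
    rw [mul_zero, ENNReal.ofReal_zero, zero_mul] at hlim
    refine le_antisymm (ge_of_tendsto hlim ?_) zero_le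
    filter_upwards [Ioc_mem_nhdsGT (show (0 : ℝ) < 1 / 2 by norm_num)] with ε hε
    exact key ε hε.1 hε.2
  -- The set varies with `ω`, so measurability goes through `atomicMass`.
  have hm : Measurable fun ω => (P ω : Measure X) (atomSet (P ω))ᶜ := by
    simp_rw [fun ω => prob_compl_eq_one_sub (μ := (P ω : Measure X))
      (countable_atomSet (P ω)).measurableSet, ← atomicMass_eq]
    exact (measurable_atomicMass.comp hP.measurable).const_sub 1
  exact (lintegral_eq_zero_iff hm).1 h0

end DirichletProcess

theorem mainTheorem1 {X : Type*} [MetricSpace X] [TopologicalSpace.SeparableSpace X]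
    [MeasurableSpace X] [BorelSpace X] :
    Measurable (fun p : ProbabilityMeasure X × X => (p.1 : Measure X) {p.2}) ∧
    Measurable (fun Q : ProbabilityMeasure X => atomicMass Q) ∧
    MeasurableSet {Q : ProbabilityMeasure X | IsDiscreteProb Q} ∧
    ∀ (k : ℝ≥0) (P₀ : Measure X) [IsProbabilityMeasure P₀], 0 < k →
      ∀ {Ω : Type*} [MeasurableSpace Ω] (μ : Measure Ω) [IsProbabilityMeasure μ]
        (P : Ω → ProbabilityMeasure X), IsDirichletProcess (k • P₀) P μ →
        ∀ᵐ ω ∂μ, atomicMass (P ω) = 1 ∧ IsDiscreteProb (P ω) := by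
  have : SecondCountableTopology X := UniformSpace.secondCountable_of_separable X
  refine ⟨measurable_measure_singleton, measurable_atomicMass, ?_, ?_⟩
  · simp_rw [isDiscreteProb_iff]
    exact measurable_atomicMass (measurableSet_singleton 1)
  · intro k P₀ _ hk Ω _ μ _ P hP
    have : NeZero (k • P₀) := ⟨fun h => by
      have := congrArg (fun ν : Measure X => ν Set.univ) h
      simp [hk.ne'] at this⟩
    filter_upwards [hP.ae_measure_compl_atomSet] with ω hω
    rw [isDiscreteProb_iff, and_self, atomicMass_eq,
      ← prob_compl_eq_zero_iff (countable_atomSet _).measurableSet, hω]
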